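/- Let $\Bbbk$ be an algebraically closed field of characteristic zero and let $0\ne g\in\Bbbk[h]$. Let $S_g$ be the Smith algebra, i.e. the unital associative $\Bbbk$-algebra generated by $x,y,h$ with relations $[h,y]=y$, $[h,x]=-x$, $[y,x]=g(h)$. Let $u\in\Bbbk[h]$ satisfy $g(h)=u(h-1)-u(h)$, let $C\in\Bbbk$, let $R=R_{u+C}$ be the multiset of roots of $u+C$ (with multiplicity), and let $X\subseteq R$ be a submultiset. Put $q(h)=\prod_{\alpha\in X}(h-\alpha)$ and $p(h)=\dfrac{u(h-1)+C}{q(h-1)}\in\Bbbk[h]$, and let $A_C(X)$ be the $S_g$-module $\Bbbk[h]$ on which $h$ acts by multiplication and $$x\,f(h)=f(h+1)\,q(h),\qquad y\,f(h)=f(h-1)\,p(h)\qquad (f\in\Bbbk[h]).$$ For $\alpha,\beta\in\Bbbk$ write $\alpha\preccurlyeq\beta$ if $\beta-\alpha\in\mathbb Z_{\ge 0}$, and $\alpha\prec\beta$ if moreover $\alpha\ne\beta$. For $\beta\in\Bbbk$ set $$\varphi_X(\beta)=\min\bigl\{\,|\{\alpha\in R\setminus X:\alpha\prec\beta\}|,\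 |\{\alpha\in X:\beta\preccurlyeq\alpha\}|\,\bigr\},$$ where the difference and the cardinalities are those of multisets (counted with multiplicity). Then $A_C(X)$ belongs to the category $\mathfrak U_1$ of $S_g$-modules that are free of rank one over the subalgebra $\Bbbk[h]\subseteq S_g$, and it has finite length as an $S_g$-module, equal to $$1+\sum_{\beta\in\underline{R}}\varphi_X(\beta),$$ where $\underline{R}$ is the set of distinct roots of $u+C$. -/

import Mathlib

namespace SmithAlg

open Polynomial

/-- The three generators of the Smith algebra. -/
inductive Gen : Type
  | x
  | y
  | h

section Algebra

variable {k : Type*} [Field k]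

/-- The defining relations `[h, y] = y`, `[h, x] = -x`, `[y, x] = g(h)`. -/
inductive Rel (g : k[X]) : FreeAlgebra k Gen → FreeAlgebra k Gen → Prop
  | hy : Rel g (FreeAlgebra.ι k Gen.h * FreeAlgebra.ι k Gen.y
      - FreeAlgebra.ι k Gen.y * FreeAlgebra.ι k Gen.h) (FreeAlgebra.ι k Gen.y)
  | hx : Rel g (FreeAlgebra.ι k Gen.h * FreeAlgebra.ι k Gen.x
      - FreeAlgebra.ι k Gen.x * FreeAlgebra.ι k Gen.h) (-FreeAlgebra.ι k Gen.x)
  | yx : Rel g (FreeAlgebra.ι k Gen.y * FreeAlgebra.ι k Gen.x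
      - FreeAlgebra.ι k Gen.x * FreeAlgebra.ι k Gen.y) (aeval (FreeAlgebra.ι k Gen.h) g)

/-- The Smith algebra attached to `g`: the unital associative `k`-algebra generated by
`x, y, h` subject to the relations `Rel g`. -/
abbrev SmithAlgebra (g : k[X]) : Type _ := RingQuot (Rel g)

/-- The image of a generator in the Smith algebra. -/
def gen (g : k[X]) (i : Gen) : SmithAlgebra g :=
  RingQuot.mkAlgHom k (Rel g) (FreeAlgebra.ι k i)

/-- The unital subalgebra `k[h]` of the Smith algebra. -/
abbrev subalgH (g : k[X]) : Subalgebra k (SmithAlgebra g) :=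
  Algebra.adjoin k {gen g Gen.h}

/-- A module over the Smith algebra lies in the category `𝔘₁` when it is free of rank one over
the subalgebra `k[h]`. -/
def InUOne (g : k[X]) (M : Type*) [AddCommGroup M] [Module (SmithAlgebra g) M] : Prop :=
  Module.Free (subalgH g) M ∧ Module.finrank (subalgH g) M = 1

/-- The monic polynomial whose multiset of roots is `Z`. -/
noncomputable def polyOf (Z : Multiset k) : k[X] := (Z.map fun a => X - C a).prod

/-- The polynomial `p(h) = (u(h-1) + c) / q(h-1)` with `q = polyOf Z`. The division is exact when
`Z` is a submultiset of the roots of `u + c`. -/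
noncomputable def pPoly (u : k[X]) (c : k) (Z : Multiset k) : k[X] :=
  (u.comp (X - 1) + C c) / (polyOf Z).comp (X - 1)

/-- The `k`-linear operator `f(h) ↦ f(h+1) q(h)` on `k[h]`. -/
noncomputable def opX (q : k[X]) : Module.End k k[X] where
  toFun f := f.comp (X + 1) * q
  map_add' f f' := by simp [add_mul]
  map_smul' a f := by simp [smul_comp]

/-- The `k`-linear operator `f(h) ↦ f(h-1) p(h)` on `k[h]`. -/
noncomputable def opY (p : k[X]) : Module.End k k[X] where
  toFun f := f.comp (X - 1) * p
  map_add' f f' := by simp [add_mul]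
  map_smul' a f := by simp [smul_comp]

/-- The `k`-linear operator `f(h) ↦ h f(h)` on `k[h]`. -/
noncomputable def opH : Module.End k k[X] := Algebra.lmul k k[X] X

theorem comp_sub_mul_pPoly {u : k[X]} {c : k} {Z : Multiset k} (hZ : Z ≤ (u + C c).roots) :
    (polyOf Z).comp (X - 1) * pPoly u c Z = u.comp (X - 1) + C c := by
  have hdvd : polyOf Z ∣ u + C c := by
    by_cases h0 : u + C c = 0
    · rw [h0]; exact dvd_zero _
    · exact (Multiset.prod_X_sub_C_dvd_iff_le_roots h0 Z).2 hZ
  obtain ⟨r, hr⟩ := hdvd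
  have h1 : (polyOf Z).comp (X - 1) ∣ u.comp (X - 1) + C c := by
    refine ⟨r.comp (X - 1), ?_⟩
    rw [← mul_comp, ← hr]; simp
  exact EuclideanDomain.mul_div_cancel' (by
    have hm : (polyOf Z).Monic := monic_multiset_prod_of_monic _ _ fun a _ => monic_X_sub_C a
    have : ((polyOf Z).comp (X - C 1)).Monic := hm.comp_X_sub_C 1
    simpa using this.ne_zero) h1

theorem pPoly_comp_mul {u : k[X]} {c : k} {Z : Multiset k} (hZ : Z ≤ (u + C c).roots) :
    (pPoly u c Z).comp (X + 1) * polyOf Z = u + C c := by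
  have h := congrArg (fun f : k[X] => f.comp (X + 1)) (comp_sub_mul_pPoly hZ)
  simp only [mul_comp, add_comp, C_comp, comp_assoc, sub_comp, X_comp, one_comp,
    add_sub_cancel_right, comp_X] at h
  rw [mul_comm]; exact h

/-- The operators assigned to the generators `x, y, h` of the Smith algebra. -/
noncomputable def genOp (u : k[X]) (c : k) (Z : Multiset k) : Gen → Module.End k k[X]
  | Gen.x => opX (polyOf Z)
  | Gen.y => opY (pPoly u c Z)
  | Gen.h => opH

theorem genOp_rel {g u : k[X]} (hu : g = u.comp (X - 1) - u) {c : k} {Z : Multiset k}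
    (hZ : Z ≤ (u + C c).roots) ⦃a b : FreeAlgebra k Gen⦄ (hab : Rel g a b) :
    FreeAlgebra.lift k (genOp u c Z) a = FreeAlgebra.lift k (genOp u c Z) b := by
  have e1 := comp_sub_mul_pPoly hZ
  have e2 := pPoly_comp_mul hZ
  cases hab with
  | hy =>
    refine LinearMap.ext fun f => ?_
    simp [genOp, opY, opH]
    ring
  | hx =>
    refine LinearMap.ext fun f => ?_
    simp [genOp, opX, opH]
    ring
  | yx =>
    refine LinearMap.ext fun f => ?_
    have e3 : aeval (opH : Module.End k k[X]) g f = g * f := by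
      rw [opH, aeval_algHom_apply, aeval_X_left_apply]; rfl
    simp only [map_sub, map_mul, FreeAlgebra.lift_ι_apply, genOp, ← aeval_algHom_apply, e3,
      LinearMap.sub_apply, Module.End.mul_apply]
    simp only [opX, opY, LinearMap.coe_mk, AddHom.coe_mk, mul_comp, comp_assoc, add_comp, sub_comp,
      X_comp, one_comp, add_sub_cancel_right, sub_add_cancel, comp_X]
    rw [hu]
    linear_combination f * e1 - f * e2

/-- The representation of the Smith algebra on `k[h]` in which `h` acts by multiplication,
`x f(h) = f(h+1) q(h)` and `y f(h) = f(h-1) p(h)`. -/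
noncomputable def repA {g u : k[X]} (hu : g = u.comp (X - 1) - u) {c : k} {Z : Multiset k}
    (hZ : Z ≤ (u + C c).roots) : SmithAlgebra g →ₐ[k] Module.End k k[X] :=
  RingQuot.liftAlgHom k ⟨FreeAlgebra.lift k (genOp u c Z), genOp_rel hu hZ⟩

/-- The module `A_c(Z)`, whose underlying additive group is `k[h]`. -/
@[nolint unusedArguments]
def ModA {g u : k[X]} (_hu : g = u.comp (X - 1) - u) {c : k} {Z : Multiset k}
    (_hZ : Z ≤ (u + C c).roots) : Type _ := k[X]

noncomputable instance {g u : k[X]} (hu : g = u.comp (X - 1) - u) {c : k} {Z : Multiset k}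
    (hZ : Z ≤ (u + C c).roots) : AddCommGroup (ModA hu hZ) :=
  inferInstanceAs (AddCommGroup k[X])

noncomputable instance {g u : k[X]} (hu : g = u.comp (X - 1) - u) {c : k} {Z : Multiset k}
    (hZ : Z ≤ (u + C c).roots) : Module (SmithAlgebra g) (ModA hu hZ) :=
  Module.compHom k[X] (repA hu hZ).toRingHom

/-- The partial order on `k`: `β - α` is a natural number. -/
def Prec (α β : k) : Prop := ∃ n : ℕ, β - α = (n : k)

/-- The strict version of `Prec`. -/
def SPrec (α β : k) : Prop := Prec α β ∧ α ≠ β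

open Classical in
/-- `φ_Z(β) = min (|(R \ Z)_{≺ β}|, |Z_{≽ β}|)`, cardinalities counted with multiplicity. -/
noncomputable def phi [DecidableEq k] (R Z : Multiset k) (β : k) : ℕ :=
  min ((R - Z).filter fun α => SPrec α β).card (Z.filter fun α => Prec β α).card

end Algebra

end SmithAlg

namespace SmithAlg

/-! Since `h` acts by multiplication, a submodule is an ideal `(f)` of `k[h]` stable under `x` and
`y`, that is, `f ∣ f(h+1) q(h)` and `f ∣ f(h-1) p(h)`. Over an algebraically closed field this is a
condition on the multiplicities `m b` of the roots of `f`: `m` drops from `b` to `b + 1` by at most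
the multiplicity of `b` in `Z` and rises by at most its multiplicity in `R - Z` (`Admissible`).

Every finitely supported admissible function is bounded by `phi`, which is itself admissible, and is
determined by its values on `R`. As long as `m` is not maximal on `R`,
`Admissible.exists_add_indicator` raises it on a block meeting `R` in one point. Hence `weight`,
which is `1 + ∑ phi - ∑ m` on nonzero submodules and `0` on `⊥`, is strictly monotone and can always
be lowered by exactly one. It is therefore the height in the submodule lattice, and its value at `⊤`
is the length. -/

/-! ### Combinatorics of admissible functions -/

/-- The block `(a, t]` is where `m` can be raised by one: both boundary steps have slack, and
nothing inside it constrains. It is found at the lowest level `v` that `m` takes where `m < φ`. -/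
theorem exists_block_of_lt_max {X Y m φ : ℤ → ℕ}
    (hm : ∀ b, m b ≤ m (b + 1) + X b ∧ m (b + 1) ≤ m b + Y b)
    (hφ : ∀ b, φ b ≤ φ (b + 1) + X b ∧ φ (b + 1) ≤ φ b + Y b)
    {L U : ℤ} (hsupp : ∀ b, φ b ≠ 0 → L < b ∧ b ≤ U) (hlt : ∃ b, m b < φ b) :
    ∃ a t : ℤ, a < t ∧ m (a + 1) < m a + Y a ∧ m t < m (t + 1) + X t ∧
      ∀ b, a < b → b < t → X b = 0 ∧ Y b = 0 := by
  classical
  obtain ⟨v, ⟨b₀, hb₀, hv₀⟩, hmin⟩ : ∃ v, (∃ b, m b < φ b ∧ m b = v) ∧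
      ∀ b, m b < φ b → v ≤ m b := by
    have h : ∃ v b, m b < φ b ∧ m b = v := hlt.elim fun b hb => ⟨_, b, hb, rfl⟩
    exact ⟨Nat.find h, Nat.find_spec h, fun b hb => Nat.find_min' h ⟨b, hb, rfl⟩⟩
  have hbd : ∀ b, m b < φ b → L < b ∧ b ≤ U := fun b hb => hsupp b (by omega)
  obtain ⟨s, ⟨hs, hsv⟩, hsmax⟩ := Int.exists_greatest_of_bdd
    (P := fun b => m b < φ b ∧ m b = v) ⟨U, fun b hb => (hbd b hb.1).2⟩ ⟨b₀, hb₀, hv₀⟩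
  -- With no slack, `m` drops by the full `X s` and `φ` by no more, so `m < φ` persists at `s + 1`
  -- with a value at most `v`, against the choice of `s`.
  have hsX : m s < m (s + 1) + X s := by
    by_contra hcon
    have h1 := hm s
    have h2 := hφ s
    have h3 := hmin (s + 1) (by omega)
    have h4 := hsmax (s + 1) ⟨by omega, by omega⟩
    omega
  obtain ⟨t, ⟨ht, htv, htX⟩, htmin⟩ := Int.exists_least_of_bdd
    (P := fun b => m b < φ b ∧ m b = v ∧ m b < m (b + 1) + X b)
    ⟨L, fun b hb => (hbd b hb.1).1.le⟩ ⟨s, hs, hsv, hsX⟩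
  have hconst : ∀ n : ℕ, (∀ b, t - n ≤ b → b < t → X b = 0 ∧ Y b = 0) →
      m (t - n) = m t ∧ φ (t - n) = φ t := by
    intro n
    induction n with
    | zero => intro; simp
    | succ n ih =>
      intro h
      have h1 := ih fun b hb hb' => h b (by push_cast; omega) hb'
      have h2 := h (t - (n + 1 : ℕ)) le_rfl (by push_cast; omega)
      have h3 := hm (t - (n + 1 : ℕ))
      have h4 := hφ (t - (n + 1 : ℕ))
      rw [show t - ((n + 1 : ℕ) : ℤ) + 1 = t - n by push_cast; ring] at h3 h4
      omega
  -- Otherwise `φ` would keep its positive value `φ t` all the way down to `L`, outside its support.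
  have hex : ∃ a, a < t ∧ ¬ (X a = 0 ∧ Y a = 0) := by
    by_contra! hcon
    have h1 := hconst (t - L).toNat fun b _ hb => hcon b hb
    have h2 := hbd t ht
    rw [Int.toNat_of_nonneg (by omega), sub_sub_cancel] at h1
    exact absurd (hsupp L (by omega)).1 (lt_irrefl _)
  obtain ⟨a, ⟨hat, haXY⟩, hamax⟩ := Int.exists_greatest_of_bdd
    (P := fun a => a < t ∧ ¬ (X a = 0 ∧ Y a = 0)) ⟨t, fun b hb => hb.1.le⟩ hex
  have hgap : ∀ b, a < b → b < t → X b = 0 ∧ Y b = 0 := fun b hb hbt => by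
    by_contra hcon
    exact absurd (hamax b ⟨hbt, hcon⟩) (not_le.2 hb)
  have h1 := hconst (t - (a + 1)).toNat fun b hb hb' =>
    hgap b (by rw [Int.toNat_of_nonneg (by omega)] at hb; omega) hb'
  rw [Int.toNat_of_nonneg (by omega), sub_sub_cancel] at h1
  refine ⟨a, t, hat, ?_, htX, hgap⟩
  -- Without slack at `a`, also `m a < φ a`; minimality of `v` forces `m a = v` and `Y a = 0`, so `X
  -- a > 0` and `a` competes with the least choice `t`.
  by_contra hcon
  have h2 := hm a
  have h3 := hφ a
  have h4 := hmin a (by omega)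
  have h5 := htmin a ⟨by omega, by omega, by omega⟩
  omega

theorem height_eq_of_strictMono_of_exists_pred {P : Type*} [PartialOrder P]
    (w : P → ℕ) (hw : StrictMono w) (hpred : ∀ p n, w p = n + 1 → ∃ p' < p, w p' = n) (p : P) :
    Order.height p = w p := by
  refine le_antisymm ((Order.height_le_height_apply_of_strictMono w hw p).trans ?_) ?_
  · simp
  · generalize h : w p = n
    induction n generalizing p with
    | zero => simp
    | succ n ih =>
      obtain ⟨p', hp', hn⟩ := hpred p n h
      calc ((n + 1 : ℕ) : ℕ∞) ≤ Order.height p' + 1 := by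
            push_cast; gcongr; exact ih p' hn
        _ ≤ Order.height p := Order.height_add_one_le hp'

/-- The multiplicity function `m` changes from `b` to `b + 1` by at least `-X b` and at most
`Y b`. -/
def Admissible {k : Type*} [Add k] [One k] (X Y m : k → ℕ) : Prop :=
  ∀ b, m b ≤ m (b + 1) + X b ∧ m (b + 1) ≤ m b + Y b

theorem card_filter_eq_card_filter_add_count {α : Type*} [DecidableEq α] {P Q : α → Prop}
    [DecidablePred P] [DecidablePred Q] {b : α} (hPQ : ∀ a, P a ↔ Q a ∨ a = b) (hb : ¬ Q b)
    (s : Multiset α) : (s.filter P).card = (s.filter Q).card + s.count b := by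
  induction s using Multiset.induction_on with
  | empty => simp
  | cons a s ih =>
    simp only [← Multiset.countP_eq_card_filter, Multiset.countP_cons, Multiset.count_cons] at ih ⊢
    rcases eq_or_ne a b with rfl | hab
    · rw [if_pos ((hPQ a).2 (Or.inr rfl)), if_neg hb, if_pos rfl, ih]; ring
    · have : P a ↔ Q a := by simp [hPQ, hab]
      simp only [this, if_neg hab.symm, ih]; ring

theorem prec_add_one_add_one {k : Type*} [Field k] {α b : k} : Prec (α + 1) (b + 1) ↔ Prec α b := by
  simp [Prec]

theorem exists_natCast_notMem {k : Type*} {S : Set k} (hS : S.Finite) {e : ℕ → k}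
    (he : Function.Injective e) : ∃ n, e n ∉ S := by
  by_contra! h
  exact Set.infinite_of_injective_forall_mem he h hS

theorem count_or_iff_mem {k : Type*} [DecidableEq k] {R Z : Multiset k} (hZ : Z ≤ R) {b : k} :
    Z.count b ≠ 0 ∨ (R - Z).count b ≠ 0 ↔ b ∈ R.toFinset := by
  rw [Multiset.mem_toFinset, ← Multiset.count_ne_zero, Multiset.count_sub]
  have := Multiset.count_le_of_le b hZ
  omega

section

variable {k : Type*} [Field k] [CharZero k]

theorem prec_iff_add_one {b α : k} : Prec b α ↔ Prec (b + 1) α ∨ α = b := by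
  constructor
  · rintro ⟨n, hn⟩
    cases n with
    | zero => right; simpa [sub_eq_zero] using hn
    | succ n => left; exact ⟨n, by push_cast at hn; linear_combination hn⟩
  · rintro (⟨n, hn⟩ | rfl)
    · exact ⟨n + 1, by push_cast; linear_combination hn⟩
    · exact ⟨0, by simp⟩

theorem not_prec_add_one (b : k) : ¬ Prec (b + 1) b := by
  rintro ⟨n, hn⟩
  have : ((n + 1 : ℕ) : k) = 0 := by push_cast; linear_combination -hn
  exact n.succ_ne_zero (by exact_mod_cast this)

theorem sPrec_iff_prec_add_one {α b : k} : SPrec α b ↔ Prec (α + 1) b := by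
  rw [SPrec, prec_iff_add_one]
  constructor
  · rintro ⟨h | h, hne⟩
    · exact h
    · exact absurd h.symm hne
  · exact fun h => ⟨Or.inl h, by rintro rfl; exact not_prec_add_one _ h⟩

theorem sPrec_add_one {b α : k} : SPrec α (b + 1) ↔ SPrec α b ∨ α = b := by
  rw [sPrec_iff_prec_add_one, sPrec_iff_prec_add_one, prec_add_one_add_one, prec_iff_add_one,
    eq_comm]

/-- Off the support of `X` and `Y` admissible functions do not change from `b` to `b + 1`, so a
disagreement would propagate to all `b + n`, against finite support. -/
theorem Admissible.apply_eq_of_eqOn {X Y m m' : k → ℕ} (hm : Admissible X Y m)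
    (hm' : Admissible X Y m') (hfin : m.support.Finite) (hfin' : m'.support.Finite)
    (h : ∀ b, X b ≠ 0 ∨ Y b ≠ 0 → m b = m' b) : m = m' := by
  by_contra hne
  obtain ⟨b, hb⟩ := Function.ne_iff.1 hne
  have key : ∀ n : ℕ, m (b + n) ≠ m' (b + n) := by
    intro n
    induction n with
    | zero => simpa using hb
    | succ n ih =>
      have h1 := hm (b + n)
      have h2 := hm' (b + n)
      have h3 : X (b + n) = 0 ∧ Y (b + n) = 0 := by
        by_contra hcon
        exact ih (h _ (by tauto))
      push_cast
      rw [← add_assoc]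
      omega
  obtain ⟨n, hn⟩ := exists_natCast_notMem (hfin.union hfin') (e := fun n : ℕ => b + n)
    fun i j hij => by simpa using hij
  simp only [Set.mem_union, Function.mem_support, not_or, not_not] at hn
  exact key n (hn.1.trans hn.2.symm)

variable [DecidableEq k]

open Classical in
theorem card_filter_sPrec_add_one (s : Multiset k) (b : k) :
    (s.filter fun α => SPrec α (b + 1)).card = (s.filter fun α => SPrec α b).card + s.count b :=
  card_filter_eq_card_filter_add_count (fun _ => sPrec_add_one) (fun h => h.2 rfl) s

open Classical in
theorem card_filter_prec (s : Multiset k) (b : k) :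
    (s.filter fun α => Prec b α).card = (s.filter fun α => Prec (b + 1) α).card + s.count b :=
  card_filter_eq_card_filter_add_count (fun _ => prec_iff_add_one) (not_prec_add_one b) s

/-- From `b` to `b + 1` the first count in the minimum gains the multiplicity of `b` in `R - Z`, and
the second loses that in `Z`. -/
theorem admissible_phi (R Z : Multiset k) :
    Admissible (fun b => Z.count b) (fun b => (R - Z).count b) (phi R Z) := by
  intro b
  have h1 := card_filter_sPrec_add_one (R - Z) b
  have h2 := card_filter_prec Z b
  simp only [phi]
  omega

theorem Admissible.le_phi {R Z : Multiset k} {m : k → ℕ}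
    (hm : Admissible (fun b => Z.count b) (fun b => (R - Z).count b) m)
    (hfin : m.support.Finite) (b : k) : m b ≤ phi R Z b := by
  classical
  refine le_min ?_ ?_
  -- The rises of `m` are telescoped from a point `b - n` where `m` vanishes; the other bound
  -- telescopes its drops up to some `b + n`.
  · have key : ∀ (n : ℕ) (b : k),
        m b ≤ m (b - n) + ((R - Z).filter fun α => SPrec α b).card := by
      intro n
      induction n with
      | zero => simp
      | succ n ih =>
        intro b
        have h1 := ih (b - 1)
        have h2 := (hm (b - 1)).2
        have h3 := card_filter_sPrec_add_one (R - Z) (b - 1)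
        rw [sub_add_cancel] at h2 h3
        dsimp only at h2
        rw [show b - ((n + 1 : ℕ) : k) = b - 1 - n by push_cast; ring]
        omega
    obtain ⟨n, hn⟩ := exists_natCast_notMem hfin (e := fun n : ℕ => b - n)
      fun i j hij => by simpa using hij
    have := key n b
    simp only [Function.mem_support, not_not] at hn
    omega
  · have key : ∀ (n : ℕ) (b : k),
        m b ≤ m (b + n) + (Z.filter fun α => Prec b α).card := by
      intro n
      induction n with
      | zero => simp
      | succ n ih =>
        intro b
        have h1 := ih (b + 1)
        have h2 := (hm b).1
        have h3 := card_filter_prec Z b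
        rw [show b + ((n + 1 : ℕ) : k) = b + 1 + n by push_cast; ring]
        dsimp only at h2
        omega
    obtain ⟨n, hn⟩ := exists_natCast_notMem hfin (e := fun n : ℕ => b + n)
      fun i j hij => by simpa using hij
    have := key n b
    simp only [Function.mem_support, not_not] at hn
    omega

theorem exists_bounds_of_phi_ne_zero {R Z : Multiset k} (hZ : Z ≤ R) (b₀ : k) :
    ∃ L U : ℤ, ∀ d : ℤ, phi R Z (b₀ + d) ≠ 0 → L < d ∧ d ≤ U := by
  classical
  have hinj : Function.Injective fun d : ℤ => b₀ + (d : k) := fun i j hij => by simpa using hij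
  have hfin : {d : ℤ | b₀ + (d : k) ∈ R.toFinset}.Finite :=
    R.toFinset.finite_toSet.preimage hinj.injOn
  obtain ⟨L, hL⟩ := hfin.bddBelow
  obtain ⟨U, hU⟩ := hfin.bddAbove
  refine ⟨L, U, fun d hd => ?_⟩
  rw [← Nat.pos_iff_ne_zero, phi, lt_min_iff, Multiset.card_pos_iff_exists_mem,
    Multiset.card_pos_iff_exists_mem] at hd
  obtain ⟨⟨α, hα⟩, γ, hγ⟩ := hd
  rw [Multiset.mem_filter] at hα hγ
  obtain ⟨hα, hαd⟩ := hα
  obtain ⟨hγ, n', hn'⟩ := hγ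
  obtain ⟨n, hn⟩ := sPrec_iff_prec_add_one.1 hαd
  constructor
  · have : L ≤ d - 1 - n := hL (by
      have : b₀ + ((d - 1 - n : ℤ) : k) = α := by push_cast; linear_combination hn
      simpa only [Set.mem_ofPred_eq, this, Multiset.mem_toFinset] using
        Multiset.mem_of_le (Multiset.sub_le_self R Z) hα)
    omega
  · have : d + n' ≤ U := hU (by
      have : b₀ + ((d + n' : ℤ) : k) = γ := by push_cast; linear_combination -hn'
      simpa only [Set.mem_ofPred_eq, this, Multiset.mem_toFinset] using Multiset.mem_of_le hZ hγ)
    omega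

theorem Admissible.sum_lt_sum {R Z : Multiset k} (hZ : Z ≤ R) {m m' : k → ℕ}
    (hm : Admissible (fun b => Z.count b) (fun b => (R - Z).count b) m)
    (hm' : Admissible (fun b => Z.count b) (fun b => (R - Z).count b) m')
    (hfin : m.support.Finite) (hfin' : m'.support.Finite) (hlt : m < m') :
    ∑ b ∈ R.toFinset, m b < ∑ b ∈ R.toFinset, m' b := by
  refine Finset.sum_lt_sum (fun b _ => hlt.le b) ?_
  by_contra! hcon
  exact hlt.ne (hm.apply_eq_of_eqOn hm' hfin hfin' fun b hb =>
    (hlt.le b).antisymm (hcon b ((count_or_iff_mem hZ).1 hb)))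

theorem Admissible.exists_add_indicator {R Z : Multiset k} (hZ : Z ≤ R) {m : k → ℕ}
    (hm : Admissible (fun b => Z.count b) (fun b => (R - Z).count b) m)
    (hlt : ∑ b ∈ R.toFinset, m b < ∑ b ∈ R.toFinset, phi R Z b) :
    ∃ S : Finset k, Admissible (fun b => Z.count b) (fun b => (R - Z).count b)
        (fun b => m b + if b ∈ S then 1 else 0) ∧
      ∑ b ∈ R.toFinset, (m b + if b ∈ S then 1 else 0) = ∑ b ∈ R.toFinset, m b + 1 := by
  -- Admissibility relates only points of one coset of `ℤ`, so the integer lemma is applied on `b₀ +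
  -- ℤ`.
  obtain ⟨b₀, -, hb₀⟩ := Finset.exists_lt_of_sum_lt hlt
  obtain ⟨L, U, hLU⟩ := exists_bounds_of_phi_ne_zero hZ b₀
  have hinj : Function.Injective fun d : ℤ => b₀ + (d : k) := fun i j hij => by simpa using hij
  have hcast : ∀ d : ℤ, b₀ + ((d + 1 : ℤ) : k) = b₀ + d + 1 := fun d => by push_cast; ring
  obtain ⟨a, t, hat, ha, ht, hgap⟩ := exists_block_of_lt_max
    (X := fun d : ℤ => Z.count (b₀ + d)) (Y := fun d : ℤ => (R - Z).count (b₀ + d))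
    (m := fun d : ℤ => m (b₀ + d)) (φ := fun d : ℤ => phi R Z (b₀ + d))
    (fun d => by simpa only [hcast] using hm (b₀ + d))
    (fun d => by simpa only [hcast] using admissible_phi R Z (b₀ + d)) hLU ⟨0, by simpa using hb₀⟩
  rw [hcast] at ha ht
  set S := (Finset.Ioc a t).image fun d : ℤ => b₀ + (d : k) with hS
  have hmem : ∀ d : ℤ, b₀ + (d : k) ∈ S ↔ a < d ∧ d ≤ t := fun d => by
    rw [hS, hinj.mem_finset_image, Finset.mem_Ioc]
  refine ⟨S, fun b => ?_, ?_⟩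
  · have hb := hm b
    dsimp only at hb ⊢
    by_cases hd : ∃ d : ℤ, b = b₀ + d
    · obtain ⟨d, rfl⟩ := hd
      have h1 := hmem d
      have h2 := hmem (d + 1)
      rw [hcast] at h2
      rcases eq_or_ne d a with rfl | hda
      · simp only [h1, h2]
        split_ifs <;> omega
      rcases eq_or_ne d t with rfl | hdt
      · simp only [h1, h2]
        split_ifs <;> omega
      simp only [h1, h2]
      split_ifs <;> omega
    · have h1 : b ∉ S := fun h => by
        obtain ⟨d, -, h⟩ := Finset.mem_image.1 h
        exact hd ⟨d, h.symm⟩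
      have h2 : b + 1 ∉ S := fun h => by
        obtain ⟨d, -, h⟩ := Finset.mem_image.1 h
        exact hd ⟨d - 1, by push_cast; linear_combination -h⟩
      simpa [h1, h2] using hb
  -- The slack at `t` forces `t` to carry a root, and it is the only point of the block that does;
  -- hence the sum grows by exactly one.
  · have htR : b₀ + (t : k) ∈ R.toFinset := (count_or_iff_mem hZ).1 (by
      have := (hm (b₀ + t)).2
      by_contra! hcon
      simp only [hcon] at this ht
      omega)
    rw [Finset.sum_add_distrib, add_right_inj, Finset.sum_eq_single_of_mem _ htR,
      if_pos ((hmem t).2 ⟨hat, le_rfl⟩)]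
    intro b hb hbt
    refine if_neg fun hbS => ?_
    obtain ⟨d, hd, rfl⟩ := Finset.mem_image.1 hbS
    rw [Finset.mem_Ioc] at hd
    have hdt : d ≠ t := fun h => hbt (by rw [h])
    have := hgap d hd.1 (by omega)
    have := (count_or_iff_mem hZ).2 hb
    omega

end

open Polynomial

/-! ### Root multiplicities and divisibility -/

section Multiplicities

variable {k : Type*} [Field k]

theorem rootMultiplicity_comp_X_add_one (f : k[X]) (b : k) :
    (f.comp (X + 1)).rootMultiplicity b = f.rootMultiplicity (b + 1) := by
  simpa using rootMultiplicity_comp_C_mul_X_add_C f 1 1 b isUnit_one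

theorem rootMultiplicity_comp_X_sub_one (f : k[X]) (b : k) :
    (f.comp (X - 1)).rootMultiplicity b = f.rootMultiplicity (b - 1) := by
  simpa [sub_eq_add_neg] using rootMultiplicity_comp_C_mul_X_add_C f 1 (-1) b isUnit_one

theorem comp_X_add_one_ne_zero {f : k[X]} (hf : f ≠ 0) : f.comp (X + 1) ≠ 0 := by
  simpa using (comp_X_add_C_ne_zero_iff (t := (1 : k))).2 hf

theorem comp_X_sub_one_ne_zero {f : k[X]} (hf : f ≠ 0) : f.comp (X - 1) ≠ 0 := by
  simpa [sub_eq_add_neg] using (comp_X_add_C_ne_zero_iff (t := (-1 : k))).2 hf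

theorem dvd_iff_rootMultiplicity_le [IsAlgClosed k] {p q : k[X]} (hp : p ≠ 0) (hq : q ≠ 0) :
    p ∣ q ↔ ∀ b, p.rootMultiplicity b ≤ q.rootMultiplicity b := by
  classical
  simp only [IsAlgClosed.dvd_iff_roots_le_roots hp hq, Multiset.le_iff_count, count_roots]

theorem finite_support_rootMultiplicity {f : k[X]} (hf : f ≠ 0) :
    (fun b => f.rootMultiplicity b).support.Finite := by
  classical
  refine f.roots.toFinset.finite_toSet.subset fun b hb => ?_
  have hb : 0 < f.rootMultiplicity b := Nat.pos_of_ne_zero hb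
  simpa [hf] using (rootMultiplicity_pos hf).1 hb

theorem polyOf_ne_zero (Z : Multiset k) : polyOf Z ≠ 0 :=
  (monic_multiset_prod_of_monic _ _ fun a _ => monic_X_sub_C a).ne_zero

theorem add_C_ne_zero {g u : k[X]} (hg : g ≠ 0) (hu : g = u.comp (X - 1) - u) (c : k) :
    u + C c ≠ 0 := fun h => hg <| by
  rw [hu, eq_neg_of_add_eq_zero_left h]
  simp

theorem pPoly_ne_zero {u : k[X]} {c : k} {Z : Multiset k} (h0 : u + C c ≠ 0)
    (hZ : Z ≤ (u + C c).roots) : pPoly u c Z ≠ 0 := by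
  rintro h
  have := pPoly_comp_mul hZ
  rw [h] at this
  exact h0 (by simpa using this.symm)

variable [DecidableEq k]

theorem rootMultiplicity_polyOf (Z : Multiset k) (b : k) :
    (polyOf Z).rootMultiplicity b = Z.count b := by
  rw [← count_roots, polyOf, roots_multiset_prod_X_sub_C]

theorem rootMultiplicity_pPoly {u : k[X]} {c : k} {Z : Multiset k} (h0 : u + C c ≠ 0)
    (hZ : Z ≤ (u + C c).roots) (b : k) :
    (pPoly u c Z).rootMultiplicity (b + 1) = ((u + C c).roots - Z).count b := by
  have h := pPoly_comp_mul hZ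
  have h1 := rootMultiplicity_mul (x := b) (h ▸ h0)
  rw [h, rootMultiplicity_comp_X_add_one, rootMultiplicity_polyOf] at h1
  rw [Multiset.count_sub, count_roots]
  omega

theorem admissible_rootMultiplicity_iff [IsAlgClosed k] {u : k[X]} {c : k} {Z : Multiset k}
    (h0 : u + C c ≠ 0) (hZ : Z ≤ (u + C c).roots) {f : k[X]} (hf : f ≠ 0) :
    Admissible (fun b => Z.count b) (fun b => ((u + C c).roots - Z).count b)
        (fun b => f.rootMultiplicity b) ↔
      f ∣ opX (polyOf Z) f ∧ f ∣ opY (pPoly u c Z) f := by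
  have hx : f.comp (X + 1) * polyOf Z ≠ 0 :=
    mul_ne_zero (comp_X_add_one_ne_zero hf) (polyOf_ne_zero Z)
  have hy : f.comp (X - 1) * pPoly u c Z ≠ 0 :=
    mul_ne_zero (comp_X_sub_one_ne_zero hf) (pPoly_ne_zero h0 hZ)
  change _ ↔ f ∣ f.comp (X + 1) * polyOf Z ∧ f ∣ f.comp (X - 1) * pPoly u c Z
  rw [dvd_iff_rootMultiplicity_le hf hx, dvd_iff_rootMultiplicity_le hf hy, Admissible,
    forall_and]
  refine and_congr (forall_congr' fun b => ?_)
    -- The bound on rises at `b` is the divisibility condition for `y` at the point `b + 1`, hence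
    -- the shift.
    ((Equiv.addRight (1 : k)).forall_congr fun b => ?_)
  · rw [rootMultiplicity_mul hx, rootMultiplicity_comp_X_add_one, rootMultiplicity_polyOf]
  · rw [Equiv.coe_addRight, rootMultiplicity_mul hy, rootMultiplicity_comp_X_sub_one,
      rootMultiplicity_pPoly h0 hZ, add_sub_cancel_right]

theorem rootMultiplicity_mul_prod_X_sub_C {f : k[X]} (hf : f ≠ 0) (S : Finset k) (b : k) :
    (f * ∏ a ∈ S, (X - C a)).rootMultiplicity b =
      f.rootMultiplicity b + if b ∈ S then 1 else 0 := by
  have hS : ∏ a ∈ S, (X - C a) ≠ 0 := Finset.prod_ne_zero_iff.2 fun a _ => X_sub_C_ne_zero a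
  rw [rootMultiplicity_mul (mul_ne_zero hf hS), ← count_roots (∏ a ∈ S, (X - C a)),
    roots_prod_X_sub_C, Multiset.count_eq_of_nodup S.nodup]
  simp

end Multiplicities

/-! ### Submodules as stable ideals, and their weight -/

section Submodules

variable {k : Type*} [Field k] {g u : k[X]} (hu : g = u.comp (X - 1) - u) {c : k}
  {Z : Multiset k} (hZ : Z ≤ (u + C c).roots)

/-- The identification of `k[h]` with the additive group of `A_c(Z)`. -/
noncomputable def ofPoly : k[X] ≃+ ModA hu hZ := AddEquiv.refl k[X]

theorem smul_ofPoly (s : SmithAlgebra g) (f : k[X]) :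
    s • ofPoly hu hZ f = ofPoly hu hZ (repA hu hZ s f) := rfl

theorem repA_mkAlgHom (a : FreeAlgebra k Gen) :
    repA hu hZ (RingQuot.mkAlgHom k (Rel g) a) = FreeAlgebra.lift k (genOp u c Z) a := by
  rw [repA, RingQuot.liftAlgHom_mkAlgHom_apply]

theorem repA_gen (i : Gen) : repA hu hZ (gen g i) = genOp u c Z i := by
  rw [gen, repA_mkAlgHom, FreeAlgebra.lift_ι_apply]

theorem repA_aeval_gen_h (p f : k[X]) : repA hu hZ (aeval (gen g Gen.h) p) f = p * f := by
  rw [← aeval_algHom_apply, repA_gen]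
  change aeval (Algebra.lmul k k[X] X) p f = p * f
  rw [aeval_algHom_apply, aeval_X_left_apply]
  rfl

theorem repA_mem {I : Ideal k[X]} (hx : ∀ f ∈ I, opX (polyOf Z) f ∈ I)
    (hy : ∀ f ∈ I, opY (pPoly u c Z) f ∈ I) (s : SmithAlgebra g) :
    ∀ f ∈ I, repA hu hZ s f ∈ I := by
  obtain ⟨a, rfl⟩ := RingQuot.mkAlgHom_surjective k (Rel g) s
  rw [repA_mkAlgHom]
  induction a using FreeAlgebra.induction with
  | grade0 r =>
    intro f hf
    rw [AlgHom.commutes, Module.algebraMap_end_apply, smul_eq_C_mul]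
    exact I.mul_mem_left _ hf
  | grade1 i =>
    intro f hf
    rw [FreeAlgebra.lift_ι_apply]
    cases i with
    | x => exact hx f hf
    | y => exact hy f hf
    | h => exact I.mul_mem_left X hf
  | mul a b iha ihb =>
    intro f hf
    rw [map_mul]
    exact iha _ (ihb f hf)
  | add a b iha ihb =>
    intro f hf
    rw [map_add]
    exact I.add_mem (iha f hf) (ihb f hf)

variable {hu hZ}

/-- The ideal of `k[h]` underlying a submodule of `A_c(Z)`. -/
def idealOf (N : Submodule (SmithAlgebra g) (ModA hu hZ)) : Ideal k[X] where
  carrier := {f | ofPoly hu hZ f ∈ N}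
  add_mem' {f f'} hf hf' := by
    rw [Set.mem_ofPred_eq] at hf hf' ⊢
    rw [map_add]
    exact N.add_mem hf hf'
  zero_mem' := by simp
  smul_mem' p f hf := by
    rw [Set.mem_ofPred_eq] at hf ⊢
    have := N.smul_mem (aeval (gen g Gen.h) p) hf
    rwa [smul_ofPoly, repA_aeval_gen_h] at this

theorem mem_idealOf {N : Submodule (SmithAlgebra g) (ModA hu hZ)} {f : k[X]} :
    f ∈ idealOf N ↔ ofPoly hu hZ f ∈ N := Iff.rfl

theorem idealOf_le_idealOf {N N' : Submodule (SmithAlgebra g) (ModA hu hZ)} :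
    idealOf N ≤ idealOf N' ↔ N ≤ N' := Iff.rfl

theorem idealOf_eq_bot {N : Submodule (SmithAlgebra g) (ModA hu hZ)} :
    idealOf N = ⊥ ↔ N = ⊥ := by
  simp only [eq_bot_iff]
  exact Iff.rfl

theorem opX_mem_idealOf {N : Submodule (SmithAlgebra g) (ModA hu hZ)} {f : k[X]}
    (hf : f ∈ idealOf N) : opX (polyOf Z) f ∈ idealOf N := by
  have := N.smul_mem (gen g Gen.x) (mem_idealOf.1 hf)
  rwa [smul_ofPoly, repA_gen] at this

theorem opY_mem_idealOf {N : Submodule (SmithAlgebra g) (ModA hu hZ)} {f : k[X]}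
    (hf : f ∈ idealOf N) : opY (pPoly u c Z) f ∈ idealOf N := by
  have := N.smul_mem (gen g Gen.y) (mem_idealOf.1 hf)
  rwa [smul_ofPoly, repA_gen] at this

theorem exists_idealOf_eq_span {f : k[X]} (hx : f ∣ opX (polyOf Z) f)
    (hy : f ∣ opY (pPoly u c Z) f) :
    ∃ N : Submodule (SmithAlgebra g) (ModA hu hZ), idealOf N = Ideal.span {f} := by
  refine ⟨{ carrier := {m | (ofPoly hu hZ).symm m ∈ Ideal.span {f}}
            add_mem' := fun {m m'} hm hm' => ?_
            zero_mem' := by simp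
            smul_mem' := fun s m hm => ?_ }, ?_⟩
  · simpa only [Set.mem_ofPred_eq, map_add] using Ideal.add_mem _ hm hm'
  · refine repA_mem hu hZ (I := Ideal.span {f}) ?_ ?_ s _ hm
    · intro f' hf'
      obtain ⟨r, rfl⟩ := Ideal.mem_span_singleton.1 hf'
      refine Ideal.mem_span_singleton.2 ?_
      change f ∣ (f * r).comp (X + 1) * polyOf Z
      rw [mul_comp, mul_right_comm]
      exact hx.mul_right _
    · intro f' hf'
      obtain ⟨r, rfl⟩ := Ideal.mem_span_singleton.1 hf'
      refine Ideal.mem_span_singleton.2 ?_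
      change f ∣ (f * r).comp (X - 1) * pPoly u c Z
      rw [mul_comp, mul_right_comm]
      exact hy.mul_right _
  · rfl

/-- A generator of the ideal underlying a submodule of `A_c(Z)`. -/
noncomputable def genPoly (N : Submodule (SmithAlgebra g) (ModA hu hZ)) : k[X] :=
  Submodule.IsPrincipal.generator (idealOf N)

theorem span_genPoly (N : Submodule (SmithAlgebra g) (ModA hu hZ)) :
    Ideal.span {genPoly N} = idealOf N :=
  Ideal.span_singleton_generator _

theorem genPoly_mem (N : Submodule (SmithAlgebra g) (ModA hu hZ)) : genPoly N ∈ idealOf N :=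
  Submodule.IsPrincipal.generator_mem _

theorem genPoly_dvd_iff {N : Submodule (SmithAlgebra g) (ModA hu hZ)} {f : k[X]} :
    genPoly N ∣ f ↔ f ∈ idealOf N := by
  rw [← span_genPoly, Ideal.mem_span_singleton]

theorem genPoly_dvd_genPoly {N N' : Submodule (SmithAlgebra g) (ModA hu hZ)} :
    genPoly N' ∣ genPoly N ↔ N ≤ N' := by
  rw [← idealOf_le_idealOf, ← span_genPoly, ← span_genPoly,
    Ideal.span_singleton_le_span_singleton]

theorem genPoly_ne_zero {N : Submodule (SmithAlgebra g) (ModA hu hZ)} (hN : N ≠ ⊥) :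
    genPoly N ≠ 0 := fun h => hN <| by
  rw [← idealOf_eq_bot, ← span_genPoly, h, Ideal.span_singleton_eq_bot]

variable [DecidableEq k]

open Classical in
/-- The length of a submodule of `A_c(Z)`, in terms of the root multiplicities of a generator. -/
noncomputable def weight (N : Submodule (SmithAlgebra g) (ModA hu hZ)) : ℕ :=
  if N = ⊥ then 0 else
    1 + ∑ b ∈ (u + C c).roots.toFinset, phi (u + C c).roots Z b -
      ∑ b ∈ (u + C c).roots.toFinset, (genPoly N).rootMultiplicity b

theorem weight_bot : weight (⊥ : Submodule (SmithAlgebra g) (ModA hu hZ)) = 0 := if_pos rfl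

theorem weight_of_ne_bot {N : Submodule (SmithAlgebra g) (ModA hu hZ)} (hN : N ≠ ⊥) :
    weight N = 1 + ∑ b ∈ (u + C c).roots.toFinset, phi (u + C c).roots Z b -
      ∑ b ∈ (u + C c).roots.toFinset, (genPoly N).rootMultiplicity b := if_neg hN

theorem weight_top : weight (⊤ : Submodule (SmithAlgebra g) (ModA hu hZ)) =
    1 + ∑ b ∈ (u + C c).roots.toFinset, phi (u + C c).roots Z b := by
  have hone : IsUnit (genPoly (⊤ : Submodule (SmithAlgebra g) (ModA hu hZ))) :=
    isUnit_of_dvd_one (genPoly_dvd_iff.2 (mem_idealOf.2 Submodule.mem_top))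
  have hbot : (⊤ : Submodule (SmithAlgebra g) (ModA hu hZ)) ≠ ⊥ := fun h => by
    have : (1 : k[X]) ∈ idealOf (⊤ : Submodule (SmithAlgebra g) (ModA hu hZ)) :=
      mem_idealOf.2 Submodule.mem_top
    rw [idealOf_eq_bot.2 h, Ideal.mem_bot] at this
    exact one_ne_zero this
  obtain ⟨r, -, hr⟩ := isUnit_iff.1 hone
  simp [weight_of_ne_bot hbot, ← hr]

variable [IsAlgClosed k]

theorem admissible_genPoly (h0 : u + C c ≠ 0)
    {N : Submodule (SmithAlgebra g) (ModA hu hZ)} (hN : N ≠ ⊥) :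
    Admissible (fun b => Z.count b) (fun b => ((u + C c).roots - Z).count b)
      (fun b => (genPoly N).rootMultiplicity b) :=
  (admissible_rootMultiplicity_iff h0 hZ (genPoly_ne_zero hN)).2
    ⟨genPoly_dvd_iff.2 (opX_mem_idealOf (genPoly_mem N)),
      genPoly_dvd_iff.2 (opY_mem_idealOf (genPoly_mem N))⟩

variable [CharZero k]

/-- This also ensures that the subtraction in `weight` never truncates and that nonzero submodules
have weight at least one. -/
theorem sum_rootMultiplicity_genPoly_le (h0 : u + C c ≠ 0)
    {N : Submodule (SmithAlgebra g) (ModA hu hZ)} (hN : N ≠ ⊥) :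
    ∑ b ∈ (u + C c).roots.toFinset, (genPoly N).rootMultiplicity b ≤
      ∑ b ∈ (u + C c).roots.toFinset, phi (u + C c).roots Z b :=
  Finset.sum_le_sum fun b _ => (admissible_genPoly h0 hN).le_phi
    (finite_support_rootMultiplicity (genPoly_ne_zero hN)) b

theorem weight_strictMono (h0 : u + C c ≠ 0) :
    StrictMono (weight : Submodule (SmithAlgebra g) (ModA hu hZ) → ℕ) := by
  intro N N' hlt
  have hN' : N' ≠ ⊥ := (bot_le.trans_lt hlt).ne'
  have h1 := sum_rootMultiplicity_genPoly_le h0 hN'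
  rcases eq_or_ne N ⊥ with rfl | hN
  · rw [weight_bot, weight_of_ne_bot hN']
    omega
  have h2 := sum_rootMultiplicity_genPoly_le h0 hN
  have hf := genPoly_ne_zero hN
  have hf' := genPoly_ne_zero hN'
  have h3 := Admissible.sum_lt_sum hZ (admissible_genPoly h0 hN') (admissible_genPoly h0 hN)
    (finite_support_rootMultiplicity hf') (finite_support_rootMultiplicity hf) (by
      -- Order reverses: the smaller submodule has the generator with larger multiplicities.
      rw [lt_iff_le_not_ge, Pi.le_def, Pi.le_def, ← dvd_iff_rootMultiplicity_le hf' hf,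
        ← dvd_iff_rootMultiplicity_le hf hf', genPoly_dvd_genPoly, genPoly_dvd_genPoly,
        ← lt_iff_le_not_ge]
      exact hlt)
  rw [weight_of_ne_bot hN, weight_of_ne_bot hN']
  omega

theorem exists_lt_weight_eq (h0 : u + C c ≠ 0)
    (N : Submodule (SmithAlgebra g) (ModA hu hZ)) (n : ℕ) (hn : weight N = n + 1) :
    ∃ N' < N, weight N' = n := by
  have hN : N ≠ ⊥ := by
    rintro rfl
    rw [weight_bot] at hn
    omega
  rcases eq_or_ne n 0 with rfl | hn0
  -- The summand `1` in `weight` accounts for this last step down to `⊥`.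
  · exact ⟨⊥, bot_lt_iff_ne_bot.2 hN, weight_bot⟩
  rw [weight_of_ne_bot hN] at hn
  have hf := genPoly_ne_zero hN
  obtain ⟨S, hS, hsum⟩ := (admissible_genPoly h0 hN).exists_add_indicator hZ (by omega)
  set f := genPoly N * ∏ a ∈ S, (X - C a) with hfS
  have hf0 : f ≠ 0 :=
    mul_ne_zero hf (Finset.prod_ne_zero_iff.2 fun a _ => X_sub_C_ne_zero a)
  simp only [← rootMultiplicity_mul_prod_X_sub_C hf, ← hfS] at hS hsum
  obtain ⟨hx, hy⟩ := (admissible_rootMultiplicity_iff h0 hZ hf0).1 hS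
  obtain ⟨N', hN'⟩ := exists_idealOf_eq_span (hu := hu) (hZ := hZ) hx hy
  have hbot : N' ≠ ⊥ := by
    rw [Ne, ← idealOf_eq_bot, hN', Ideal.span_singleton_eq_bot]
    exact hf0
  have hassoc : Associated (genPoly N') f := by
    rw [← Ideal.span_singleton_eq_span_singleton, span_genPoly, hN']
  have hmult : ∀ b, (genPoly N').rootMultiplicity b = f.rootMultiplicity b := fun b =>
    le_antisymm ((dvd_iff_rootMultiplicity_le (genPoly_ne_zero hbot) hf0).1 hassoc.dvd b)
      ((dvd_iff_rootMultiplicity_le hf0 (genPoly_ne_zero hbot)).1 hassoc.symm.dvd b)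
  refine ⟨N', lt_of_le_of_ne ?_ ?_, ?_⟩
  · exact genPoly_dvd_genPoly.1 ((Dvd.intro _ rfl).trans hassoc.symm.dvd)
  · rintro rfl
    simp only [hmult] at hsum
    omega
  · rw [weight_of_ne_bot hbot]
    simp only [hmult]
    omega

end Submodules

/-! ### Freeness of rank one over `k[h]` -/

section FreeOfRankOne

variable {k : Type*} [Field k] {g u : k[X]} (hu : g = u.comp (X - 1) - u) {c : k}
  {Z : Multiset k} (hZ : Z ≤ (u + C c).roots)

theorem mem_subalgH_iff {s : SmithAlgebra g} :
    s ∈ subalgH g ↔ ∃ p : k[X], aeval (gen g Gen.h) p = s := by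
  rw [subalgH, Algebra.adjoin_singleton_eq_range_aeval]
  rfl

/-- The orbit map `s ↦ s • 1` identifies `k[h] ⊆ S_g` with `A_c(Z)`. -/
noncomputable def subalgHEquiv : subalgH g ≃ₗ[subalgH g] ModA hu hZ :=
  LinearEquiv.ofBijective (LinearMap.toSpanSingleton (subalgH g) _ (ofPoly hu hZ 1)) <| by
    have key : ∀ p : k[X], aeval (gen g Gen.h) p • ofPoly hu hZ 1 = ofPoly hu hZ p := fun p => by
      rw [smul_ofPoly, repA_aeval_gen_h, mul_one]
    constructor
    · rw [injective_iff_map_eq_zero]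
      rintro ⟨s, hs⟩ h
      obtain ⟨p, rfl⟩ := mem_subalgH_iff.1 hs
      have hp : p = 0 := (ofPoly hu hZ).map_eq_zero_iff.1 ((key p).symm.trans h)
      exact Subtype.ext (by simp [hp])
    · intro m
      obtain ⟨p, rfl⟩ := (ofPoly hu hZ).surjective m
      exact ⟨⟨_, mem_subalgH_iff.2 ⟨p, rfl⟩⟩, key p⟩

theorem inUOne_modA : InUOne g (ModA hu hZ) := by
  let e := subalgHEquiv hu hZ
  have hsurj : Function.Surjective
      ((aeval (gen g Gen.h) : k[X] →ₐ[k] SmithAlgebra g).codRestrict (subalgH g)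
        fun p => mem_subalgH_iff.2 ⟨p, rfl⟩) := fun ⟨s, hs⟩ => by
    obtain ⟨p, rfl⟩ := mem_subalgH_iff.1 hs
    exact ⟨p, rfl⟩
  -- As a quotient of `k[X]` the subalgebra is Noetherian; together with nontriviality this gives
  -- the rank condition that `Module.finrank_self` needs.
  have : IsNoetherianRing (subalgH g) := isNoetherianRing_of_surjective _ _
    ((aeval (gen g Gen.h) : k[X] →ₐ[k] SmithAlgebra g).codRestrict (subalgH g)
        fun p => mem_subalgH_iff.2 ⟨p, rfl⟩).toRingHom hsurj
  have : Nontrivial (ModA hu hZ) := inferInstanceAs (Nontrivial k[X])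
  have : Nontrivial (subalgH g) := e.toEquiv.nontrivial
  exact ⟨Module.Free.of_equiv e, by rw [← e.finrank_eq, Module.finrank_self]⟩

end FreeOfRankOne

end SmithAlg

theorem mainTheorem2 {k : Type*} [Field k] [IsAlgClosed k] [CharZero k] [DecidableEq k]
    (g u : Polynomial k) (hg : g ≠ 0)
    (hu : g = u.comp (Polynomial.X - 1) - u)
    (c : k) (Z : Multiset k) (hZ : Z ≤ (u + Polynomial.C c).roots) :
    SmithAlg.InUOne g (SmithAlg.ModA hu hZ) ∧
    Module.length (SmithAlg.SmithAlgebra g) (SmithAlg.ModA hu hZ) =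
      ((1 + ∑ β ∈ (u + Polynomial.C c).roots.toFinset,
        SmithAlg.phi (u + Polynomial.C c).roots Z β : ℕ) : ℕ∞) := by
  have h0 := SmithAlg.add_C_ne_zero hg hu c
  refine ⟨SmithAlg.inUOne_modA hu hZ, ?_⟩
  rw [Module.length_eq_height, SmithAlg.height_eq_of_strictMono_of_exists_pred SmithAlg.weight
    (SmithAlg.weight_strictMono h0) (SmithAlg.exists_lt_weight_eq h0), SmithAlg.weight_top]
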